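/- Consider the downlink from an $N$-antenna base station to a single-antenna user terminal. The channel is $\mathbf{h}\sim\mathcal{CN}(\mathbf{0},\mathbf{R})$ with $\mathbf{R}\in\mathbb{C}^{N\times N}$ positive semi-definite with diagonal entries $r_{11},\dots,r_{NN}>0$. For a unit-norm beamforming vector $\mathbf{w}\in\mathbb{C}^N$ and a data signal $s$, the received signal is $$y=\mathbf{h}^T(\mathbf{w}s+\boldsymbol{\eta}_t^{\mathrm{BS}})+n+\eta_r^{\mathrm{UT}},$$ where, given $\mathbf{h}$, the noises $\boldsymbol{\eta}_t^{\mathrm{BS}}\sim\mathcal{CN}\big(\mathbf{0},\kappa_t^{\mathrm{BS}}p^{\mathrm{BS}}\,\mathrm{diag}(|w_1|^2,\dots,|w_N|^2)\big)$, $n\sim\mathcal{CN}(0,\sigma_{\mathrm{UT}}^2)$ and $\eta_r^{\mathrm{UT}}\sim\mathcal{CN}(0,\kappa_r^{\mathrm{UT}}p^{\mathrm{BS}}|\mathbf{h}^T\mathbf{w}|^2)$ are independent of each other and of $s$; here $p^{\mathrm{BS}},\sigma_{\mathrm{UT}}^2,\kappa_t^{\mathrm{BS}}>0$ and $\kappa_r^{\mathrm{UT}}\ge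 0$. The base station knows an estimate $\hat{\mathbf{h}}$, an arbitrary $\mathbb{C}^N$-valued random vector jointly distributed with $\mathbf{h}$. The user terminal observes $y$ together with arbitrary side information $u$, whose conditional law given $(\mathbf{h},\hat{\mathbf{h}},\mathbf{w})$ is arbitrary and which is, given these, independent of $s$ and of the noises (this covers everything from no channel knowledge to perfect channel knowledge). The capacity, in bits per channel use, is $$\mathtt{C}=\mathbb{E}\Big\{\sup_{\mathbf{w}(\hat{\mathbf{h}}):\,\|\mathbf{w}\|=1}\ \sup_{f(s):\,\mathbb{E}\{|s|^2\}\le p^{\mathrm{BS}}}\mathcal{I}(s;y,u)\Big\},$$ where the mutual information $\mathcal{I}$ is computed under the conditional law given the realization of $\hat{\mathbf{h}}$, the signal $s\sim f$ is (conditionally) independent of $\mathbf{h}$, and the outer expectation is over $\hat{\mathbf{h}}$. Then $$\mathtt{C}\le\mathtt{C}_{\mathrm{upper}}=\log_2\left(1+\frac{G}{1+\kappa_r^{\mathrm{UT}}G}\right),$$ $$G=\sum_{i=1}^N\frac{1}{\kappa_t^{\mathrm{BS}}}\left(1-x_i\,E_1(x_i)\,e^{x_i}\right),\qquad x_i=\frac{\sigma_{\mathrm{UT}}^2}{p^{\mathrm{BS}}\kappa_t^{\mathrm{BS}}r_{ii}},$$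 where $E_1(x)=\int_1^\infty \frac{e^{-tx}}{t}\,dt$ denotes the exponential integral. -/

import Mathlib

open MeasureTheory ProbabilityTheory InformationTheory
open scoped NNReal ENNReal ComplexConjugate ComplexOrder

noncomputable section

namespace MISO

/-- The space `ℂ^N` of channel vectors, channel estimates and beamforming vectors, with its
Euclidean norm. -/
abbrev Vec (N : ℕ) : Type := EuclideanSpace ℂ (Fin N)

/-- The (unconjugated) product `hᵀ w`. -/
def dotT {N : ℕ} (h w : Vec N) : ℂ := ∑ i, h i * w i

/-! ### Circularly-symmetric complex Gaussian laws -/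

/-- The scalar law `CN(0, v)`: real and imaginary part are independent and `N(0, v / 2)`. -/
def complexGaussian (v : ℝ≥0) : Measure ℂ :=
  ((gaussianReal 0 (v / 2)).prod (gaussianReal 0 (v / 2))).map
    Complex.measurableEquivRealProd.symm

instance (v : ℝ≥0) : IsProbabilityMeasure (complexGaussian v) :=
  Measure.isProbabilityMeasure_map (by fun_prop)

/-- The Markov kernel `v ↦ CN(0, v)`. -/
def complexGaussianKernel : Kernel ℝ≥0 ℂ where
  toFun := complexGaussian
  measurable' := by
    let k : Kernel ℝ≥0 ℝ :=
      ⟨fun v => gaussianReal 0 (v / 2), measurable_gaussianReal.comp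
        (measurable_const.prodMk (measurable_id.div_const 2))⟩
    have : IsMarkovKernel k :=
      ⟨fun v => inferInstanceAs (IsProbabilityMeasure (gaussianReal 0 (v / 2)))⟩
    have h := ((k ×ₖ k).map Complex.measurableEquivRealProd.symm).measurable
    convert! h using 1
    funext v
    rw [Kernel.map_apply _ (by fun_prop), Kernel.prod_apply]
    rfl

instance : IsMarkovKernel complexGaussianKernel :=
  ⟨fun v => inferInstanceAs (IsProbabilityMeasure (complexGaussian v))⟩

/-- `μ` is the law `CN(0, R)` on `ℂ^N`: for every `c`, the linear functional `x ↦ cᴴ x` has the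
law `CN(0, cᴴ R c)` under `μ`. -/
def IsComplexGaussian {N : ℕ} (R : Matrix (Fin N) (Fin N) ℂ) (μ : Measure (Vec N)) : Prop :=
  ∀ c : Fin N → ℂ, μ.map (fun x : Vec N => ∑ i, conj (c i) * x i) =
    complexGaussian (star c ⬝ᵥ R.mulVec c).re.toNNReal

/-! ### The downlink channel with transceiver hardware impairments -/

/-- The parameters of the downlink: signal power `p`, variance `σ2` of the receiver noise, and
the levels of impairments `κt` of the transmitter (base station) and `κr` of the receiver
(user terminal). -/
structure Downlink where
  p : ℝ≥0
  σ2 : ℝ≥0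
  κt : ℝ≥0
  κr : ℝ≥0

/-- The joint law of the noises `(ηt, n, ηr)` given the channel realization `h`, for the
beamforming vector `w`. They are independent, the transmitter distortion `ηt` is
`CN(0, κt p diag(|w_1|², …, |w_N|²))`, the receiver noise `n` is `CN(0, σ2)`, and the receiver
distortion `ηr` is `CN(0, κr p |hᵀ w|²)`. -/
def noiseKernel {N : ℕ} (D : Downlink) (w : Vec N) : Kernel (Vec N) ((Fin N → ℂ) × ℂ × ℂ) where
  toFun h := (Measure.pi fun i => complexGaussian (D.κt * D.p * ‖w i‖₊ ^ 2)).prod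
    ((complexGaussian D.σ2).prod (complexGaussian (D.κr * D.p * ‖dotT h w‖₊ ^ 2)))
  measurable' := by
    have hm : Measurable fun h : Vec N => D.κr * D.p * ‖dotT h w‖₊ ^ 2 := by
      unfold dotT; fun_prop
    have h := (Kernel.const (Vec N)
      (Measure.pi fun i => complexGaussian (D.κt * D.p * ‖w i‖₊ ^ 2)) ×ₖ
      (Kernel.const (Vec N) (complexGaussian D.σ2) ×ₖ
        complexGaussianKernel.comap _ hm)).measurable
    convert! h using 1
    funext x
    rw [Kernel.prod_apply, Kernel.prod_apply, Kernel.const_apply, Kernel.const_apply,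
      Kernel.comap_apply]
    rfl

instance {N : ℕ} (D : Downlink) (w : Vec N) : IsMarkovKernel (noiseKernel D w) :=
  ⟨fun h => inferInstanceAs (IsProbabilityMeasure
    ((Measure.pi fun i => complexGaussian (D.κt * D.p * ‖w i‖₊ ^ 2)).prod
      ((complexGaussian D.σ2).prod (complexGaussian (D.κr * D.p * ‖dotT h w‖₊ ^ 2)))))⟩

/-- The received signal `y = hᵀ (w s + ηt) + n + ηr`. -/
def received {N : ℕ} (w : Vec N) (h : Vec N) (s : ℂ) (z : (Fin N → ℂ) × ℂ × ℂ) : ℂ :=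
  (∑ i, h i * (w i * s + z.1 i)) + z.2.1 + z.2.2

lemma measurable_received {N : ℕ} (w : Vec N) :
    Measurable fun q : (Vec N × ℂ) × ((Fin N → ℂ) × ℂ × ℂ) => received w q.1.1 q.1.2 q.2 := by
  unfold received; fun_prop

/-- The law of the received signal `y` given the channel `h` and the data signal `s`. -/
def outputKernel {N : ℕ} (D : Downlink) (w : Vec N) : Kernel (Vec N × ℂ) ℂ where
  toFun q := (noiseKernel D w q.1).map (received w q.1 q.2)
  measurable' := by
    have h := (((Kernel.id : Kernel (Vec N × ℂ) (Vec N × ℂ)) ×ₖ (noiseKernel D w).comap Prod.fst measurable_fst).map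
      fun q : (Vec N × ℂ) × ((Fin N → ℂ) × ℂ × ℂ) => received w q.1.1 q.1.2 q.2).measurable
    convert! h using 1
    funext q
    rw [Kernel.map_apply _ (measurable_received w), Kernel.prod_apply, Kernel.id_apply,
      Kernel.comap_apply, Measure.dirac_prod, Measure.map_map (measurable_received w)
      (by fun_prop)]
    rfl

instance {N : ℕ} (D : Downlink) (w : Vec N) : IsMarkovKernel (outputKernel D w) :=
  ⟨fun q => Measure.isProbabilityMeasure_map
    ((measurable_received w).comp (measurable_prodMk_left (x := q))).aemeasurable⟩

/-! ### Mutual information and capacity -/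

/-- The mutual information, in bits, of two random variables with joint law `ρ`. -/
def mutualInfo {α β : Type*} [MeasurableSpace α] [MeasurableSpace β] (ρ : Measure (α × β)) :
    ℝ≥0∞ :=
  klDiv ρ ((ρ.map Prod.fst).prod (ρ.map Prod.snd)) / ENNReal.ofReal (Real.log 2)

/-- The joint law of the data signal `s` and the receiver's observation `(y, u)` when
* the channel `h` has the law `post`,
* the data signal `s` has the law `f` and is independent of `h`,
* `y` is the received signal for the beamforming vector `w`,
* `u` is side information with the conditional law `side h` given `h`; given `h` it is
  independent of the data signal and the noises. -/
def jointLaw {N : ℕ} {𝒰 : Type*} [MeasurableSpace 𝒰] (D : Downlink) (post : Measure (Vec N))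
    (side : Kernel (Vec N) 𝒰) (w : Vec N) (f : Measure ℂ) : Measure (ℂ × ℂ × 𝒰) :=
  ((post.prod f) ⊗ₘ (outputKernel D w ×ₖ side.comap Prod.fst measurable_fst)).map
    fun q : (Vec N × ℂ) × (ℂ × 𝒰) => (q.1.2, q.2)

/-- The maximal mutual information between data signal and received signal in a block in which
the estimate has the realization `e`: the supremum is over all unit-norm beamforming
vectors `w` and all laws `f` of the data signal with `E|s|² ≤ p`. Here `post e` is the conditional
law of the channel given the estimate, and `side (h, e, w)` is the law of the side information
of the user terminal given the channel, the estimate and the beamforming vector. -/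
def blockCapacity {N : ℕ} {𝒰 : Type*} [MeasurableSpace 𝒰] (D : Downlink)
    (post : Kernel (Vec N) (Vec N)) (side : Kernel (Vec N × Vec N × Vec N) 𝒰) (e : Vec N) :
    ℝ≥0∞ :=
  ⨆ (w : Vec N) (_ : ‖w‖ = 1) (f : ProbabilityMeasure ℂ)
    (_ : ∫⁻ s, ‖s‖ₑ ^ 2 ∂(f : Measure ℂ) ≤ D.p),
    mutualInfo (jointLaw D (post e)
      (side.comap (fun h => (h, e, w)) (by fun_prop)) w (f : Measure ℂ))

/-- The (outer) expectation of a `[0, ∞]`-valued function. It is the Lebesgue integral when the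
function is measurable, and it needs no measurability of the function. -/
def outerExpectation {α : Type*} [MeasurableSpace α] (μ : Measure α) (F : α → ℝ≥0∞) : ℝ≥0∞ :=
  ⨅ (g : α → ℝ≥0∞) (_ : Measurable g) (_ : ∀ x, F x ≤ g x), ∫⁻ x, g x ∂μ

lemma outerExpectation_eq_lintegral {α : Type*} [MeasurableSpace α] (μ : Measure α)
    {F : α → ℝ≥0∞} (hF : Measurable F) : outerExpectation μ F = ∫⁻ x, F x ∂μ :=
  le_antisymm (iInf_le_of_le F (iInf_le_of_le hF (iInf_le_of_le (fun _ => le_rfl) le_rfl)))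
    (le_iInf fun _ => le_iInf fun _ => le_iInf fun hg => lintegral_mono hg)

/-- The downlink capacity `E{ max_{w(ĥ) : ‖w‖ = 1} max_{f(s) : E|s|² ≤ p} I(s; y) }`, in bits per
channel use, for the channel `h`, the estimate `est = ĥ` at the base station and the side
information `side` at the user terminal. -/
def capacity {N : ℕ} {Ω : Type*} [MeasurableSpace Ω] {𝒰 : Type*} [MeasurableSpace 𝒰]
    (D : Downlink) (P : Measure Ω) [IsFiniteMeasure P] (h est : Ω → Vec N)
    (side : Kernel (Vec N × Vec N × Vec N) 𝒰) : ℝ≥0∞ :=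
  outerExpectation (P.map est) (blockCapacity D (condDistrib h est P) side)

/-! ### The closed-form bound -/

/-- The exponential integral `E₁(x) = ∫_1^∞ e^{-t x} / t dt`. -/
def expIntegralE1 (x : ℝ) : ℝ := ∫ t in Set.Ioi (1 : ℝ), Real.exp (-t * x) / t

/-- `G = ∑ i, (1 / κt) (1 - x_i E₁(x_i) e^{x_i})` with `x_i = σ2 / (p κt r_ii)`. -/
def boundG {N : ℕ} (D : Downlink) (R : Matrix (Fin N) (Fin N) ℂ) : ℝ :=
  ∑ i, 1 / (D.κt : ℝ) *
    (1 - D.σ2 / (D.p * D.κt * (R i i).re) * expIntegralE1 (D.σ2 / (D.p * D.κt * (R i i).re)) *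
      Real.exp (D.σ2 / (D.p * D.κt * (R i i).re)))

/-- `C_upper = log₂ (1 + G / (1 + κr G))`. -/
def capacityUpper {N : ℕ} (D : Downlink) (R : Matrix (Fin N) (Fin N) ℂ) : ℝ :=
  Real.logb 2 (1 + boundG D R / (1 + D.κr * boundG D R))

end MISO

end

/-! Revealing the channel `h` to the receiver can only help, and it makes `u` useless: given `h`,
the side information is independent of the signal and the noises. It remains to bound the
information about `s` in `y` with `h` known. It is at most the mean divergence of the true output
law from any reference law that depends on `h` but not on `s` (`klDiv_jointLaw_le`).

Given `h` and `s`, the output is Gaussian (`outputKernel_apply`). With a centred Gaussian reference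
of variance `outputVar`, the quadratic terms of the log-likelihood ratio contribute at most zero
under the power constraint, leaving the logarithm of `outputVar / noiseVar`
(`integral_logRatio_le`). Weighted Cauchy–Schwarz bounds this by `rate D (sinrBound D h)`, uniformly
in the beamformer (`log_outputVar_div_noiseVar_le`).

Averaging over the estimate restores the unconditional law of `h`, so the quality of the estimate
disappears. Since `rate` is concave, Jensen's inequality moves the mean inside. The mean of
`sinrBound` is a sum over antennas, so only the diagonal of `R` enters; each term is an
exponential-integral computation (`integral_sinr_term`). -/

noncomputable section

namespace MISO

/-! ### Complex Gaussian laws and the conditional law of the output -/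

section ComplexGaussian

lemma charFun_complexGaussian (v : ℝ≥0) (t : ℂ) :
    charFun (complexGaussian v) t = Complex.exp (-(v * ‖t‖ ^ 2 / 4 : ℝ)) := by
  rw [complexGaussian, charFun_apply, integral_map (by fun_prop)
    (by exact (Measurable.aestronglyMeasurable (by fun_prop)))]
  have h : ∀ q : ℝ × ℝ,
      Complex.exp (↑(inner ℝ (Complex.measurableEquivRealProd.symm q) t) * Complex.I) =
        Complex.exp (↑(inner ℝ q.1 t.re) * Complex.I) *
          Complex.exp (↑(inner ℝ q.2 t.im) * Complex.I) := by
    intro q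
    rw [← Complex.exp_add]
    congr 1
    simp [Complex.inner, Complex.measurableEquivRealProd]
    ring
  simp_rw [h]
  rw [integral_prod_mul (fun x : ℝ => Complex.exp (↑(inner ℝ x t.re) * Complex.I))
    (fun x : ℝ => Complex.exp (↑(inner ℝ x t.im) * Complex.I)),
    ← charFun_apply, ← charFun_apply, charFun_gaussianReal, charFun_gaussianReal,
    ← Complex.exp_add, Complex.sq_norm, Complex.normSq_apply]
  congr 1
  push_cast
  ring

/-- For the real inner product on `ℂ`, multiplication by `a` has adjoint multiplication by `conj a`.
With `a = -1` this gives symmetry of the law; with `a = h i` it handles each distortion term. -/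
lemma integral_exp_mul_complexGaussian (v : ℝ≥0) (a t : ℂ) :
    ∫ z, Complex.exp (↑(inner ℝ (a * z) t) * Complex.I) ∂complexGaussian v =
      Complex.exp (-(v * (‖a‖ ^ 2 * ‖t‖ ^ 2) / 4 : ℝ)) := by
  have h : ∀ z : ℂ, inner ℝ (a * z) t = inner ℝ z (conj a * t) := by
    intro z
    simp [Complex.inner]
    ring
  simp_rw [h]
  rw [← charFun_apply, charFun_complexGaussian]
  simp [mul_pow]

/-- The density of `CN(m, v)` with respect to the Lebesgue measure. -/
def gaussianDensity (v : ℝ≥0) (m z : ℂ) : ℝ := (Real.pi * v)⁻¹ * Real.exp (-(‖z - m‖ ^ 2 / v))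

lemma gaussianDensity_pos {v : ℝ≥0} (hv : 0 < v) (m z : ℂ) : 0 < gaussianDensity v m z := by
  have : (0 : ℝ) < v := hv
  unfold gaussianDensity
  positivity

lemma sq_norm_equivRealProd_symm (q : ℝ × ℝ) :
    ‖Complex.measurableEquivRealProd.symm q‖ ^ 2 = q.1 ^ 2 + q.2 ^ 2 := by
  rw [Complex.sq_norm, Complex.normSq_apply]
  simp [Complex.measurableEquivRealProd]
  ring

lemma complexGaussian_eq_withDensity {v : ℝ≥0} (hv : 0 < v) :
    complexGaussian v = volume.withDensity fun z => ENNReal.ofReal (gaussianDensity v 0 z) := by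
  have hv2 : v / 2 ≠ 0 := by positivity
  have hv' : (0 : ℝ) < v := hv
  have hmp := Complex.volume_preserving_equiv_real_prod.symm
  rw [complexGaussian, gaussianReal_of_var_ne_zero _ hv2,
    prod_withDensity (measurable_gaussianPDF _ _) (measurable_gaussianPDF _ _)]
  ext s hs
  rw [Measure.map_apply (by fun_prop) hs, withDensity_apply _ hs, withDensity_apply _
    (Complex.measurableEquivRealProd.symm.measurable hs),
    ← hmp.setLIntegral_comp_preimage hs (by unfold gaussianDensity; fun_prop)]
  refine lintegral_congr fun q => ?_
  rw [gaussianPDF, gaussianPDF, ← ENNReal.ofReal_mul (gaussianPDFReal_nonneg _ _ _)]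
  congr 1
  rw [gaussianDensity, sub_zero, sq_norm_equivRealProd_symm, gaussianPDFReal, gaussianPDFReal]
  have hs : (√(2 * Real.pi * (v / 2 : ℝ≥0)))⁻¹ * (√(2 * Real.pi * (v / 2 : ℝ≥0)))⁻¹
      = (Real.pi * v)⁻¹ := by
    rw [← mul_inv, Real.mul_self_sqrt (by positivity)]
    push_cast
    congr 1
    ring
  rw [mul_mul_mul_comm, hs, ← Real.exp_add]
  congr 2
  push_cast
  field_simp
  ring

lemma map_add_complexGaussian_eq_withDensity {v : ℝ≥0} (hv : 0 < v) (m : ℂ) :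
    (complexGaussian v).map (m + ·) =
      volume.withDensity fun z => ENNReal.ofReal (gaussianDensity v m z) := by
  rw [complexGaussian_eq_withDensity hv]
  have hmp := measurePreserving_add_left (volume : Measure ℂ) m
  ext s hs
  rw [Measure.map_apply (by fun_prop) hs, withDensity_apply _ hs, withDensity_apply _
    (measurable_const_add m hs),
    ← hmp.setLIntegral_comp_preimage hs (by unfold gaussianDensity; fun_prop)]
  simp [gaussianDensity]

lemma integrable_sq_gaussianReal (v : ℝ≥0) :
    Integrable (fun x : ℝ => x ^ 2) (gaussianReal 0 v) :=
  (memLp_id_gaussianReal 2).integrable_sq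

lemma integral_sq_gaussianReal (v : ℝ≥0) : ∫ x, x ^ 2 ∂(gaussianReal 0 v) = v := by
  have h := variance_eq_integral (X := id) (μ := gaussianReal 0 v) aemeasurable_id
  rw [variance_id_gaussianReal] at h
  simpa using h.symm

lemma integrable_sq_norm_complexGaussian (v : ℝ≥0) :
    Integrable (fun z : ℂ => ‖z‖ ^ 2) (complexGaussian v) := by
  rw [complexGaussian, integrable_map_measure (Measurable.aestronglyMeasurable (by fun_prop))
    (by fun_prop)]
  simp only [Function.comp_def, sq_norm_equivRealProd_symm]
  exact ((integrable_sq_gaussianReal _).comp_fst _).add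
    ((integrable_sq_gaussianReal _).comp_snd _)

lemma integral_sq_norm_complexGaussian (v : ℝ≥0) :
    ∫ z : ℂ, ‖z‖ ^ 2 ∂(complexGaussian v) = v := by
  rw [complexGaussian, integral_map (by fun_prop)
    (Measurable.aestronglyMeasurable (by fun_prop))]
  simp only [sq_norm_equivRealProd_symm]
  rw [integral_add ((integrable_sq_gaussianReal _).comp_fst _)
    ((integrable_sq_gaussianReal _).comp_snd _), integral_fun_fst (fun x : ℝ => x ^ 2),
    integral_fun_snd (fun x : ℝ => x ^ 2), integral_sq_gaussianReal]
  simp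

lemma integrable_id_complexGaussian (v : ℝ≥0) : Integrable (fun z : ℂ => z) (complexGaussian v) :=
  ((memLp_two_iff_integrable_sq_norm aestronglyMeasurable_id).2
    (integrable_sq_norm_complexGaussian v)).integrable one_le_two

lemma integral_id_complexGaussian (v : ℝ≥0) : ∫ z, z ∂(complexGaussian v) = 0 := by
  -- A law invariant under `z ↦ -z` has a mean equal to its own negative.
  have hneg : (complexGaussian v).map (fun z => -z) = complexGaussian v := by
    have : IsProbabilityMeasure ((complexGaussian v).map (fun z => -z)) :=
      Measure.isProbabilityMeasure_map (by fun_prop)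
    refine Measure.ext_of_charFun (funext fun t => ?_)
    rw [charFun_apply, integral_map (by fun_prop)
      (Measurable.aestronglyMeasurable (by fun_prop))]
    have := integral_exp_mul_complexGaussian v (-1) t
    simp only [neg_one_mul] at this
    rw [this, charFun_complexGaussian]
    simp
  have h := integral_map (μ := complexGaussian v) (φ := fun z : ℂ => -z) (f := fun z : ℂ => z)
    (by fun_prop) (Measurable.aestronglyMeasurable (by fun_prop))
  rw [hneg, integral_neg] at h
  exact self_eq_neg.1 h

lemma integrable_sq_norm_add_complexGaussian (v : ℝ≥0) (m : ℂ) :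
    Integrable (fun z : ℂ => ‖m + z‖ ^ 2) (complexGaussian v) :=
  (memLp_two_iff_integrable_sq_norm (Measurable.aestronglyMeasurable (by fun_prop))).1
    ((memLp_const m).add ((memLp_two_iff_integrable_sq_norm aestronglyMeasurable_id).2
      (integrable_sq_norm_complexGaussian v)))

lemma integral_sq_norm_add_complexGaussian (v : ℝ≥0) (m : ℂ) :
    ∫ z : ℂ, ‖m + z‖ ^ 2 ∂(complexGaussian v) = ‖m‖ ^ 2 + v := by
  have h : ∀ z : ℂ, ‖m + z‖ ^ 2 = (‖m‖ ^ 2 + 2 * inner ℝ m z) + ‖z‖ ^ 2 := fun z =>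
    norm_add_sq_real m z
  have hi : Integrable (fun z : ℂ => inner ℝ m z) (complexGaussian v) :=
    (integrable_id_complexGaussian v).const_inner m
  have hi' : Integrable (fun z : ℂ => ‖m‖ ^ 2 + 2 * inner ℝ m z) (complexGaussian v) :=
    (integrable_const _).add (hi.const_mul 2)
  simp_rw [h]
  rw [integral_add hi' (integrable_sq_norm_complexGaussian v), integral_add (integrable_const _) (hi.const_mul 2),
    integral_const_mul, integral_inner (integrable_id_complexGaussian v),
    integral_id_complexGaussian, integral_sq_norm_complexGaussian]
  simp

/-- The conditional variance of the received signal given the channel `h` and the data signal. -/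
def noiseVar {N : ℕ} (D : Downlink) (w h : Vec N) : ℝ≥0 :=
  (∑ i, D.κt * D.p * ‖w i‖₊ ^ 2 * ‖h i‖₊ ^ 2) + D.σ2 + D.κr * D.p * ‖dotT h w‖₊ ^ 2

/-- Given `h` and `s`, the output is a constant plus independent Gaussians, so characteristic
functions multiply and variances add. -/
lemma outputKernel_apply {N : ℕ} (D : Downlink) (w h : Vec N) (s : ℂ) :
    outputKernel D w (h, s) = (complexGaussian (noiseVar D w h)).map (dotT h w * s + ·) := by
  have : IsProbabilityMeasure ((complexGaussian (noiseVar D w h)).map (dotT h w * s + ·)) :=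
    Measure.isProbabilityMeasure_map (by fun_prop)
  refine Measure.ext_of_charFun (funext fun t => ?_)
  have hr : Measurable (received w h s) := by unfold received; fun_prop
  rw [charFun_map_const_add, charFun_complexGaussian, charFun_apply]
  change ∫ x, _ ∂(Measure.map (received w h s) (noiseKernel D w h)) = _
  rw [integral_map hr.aemeasurable (Measurable.aestronglyMeasurable (by fun_prop))]
  -- The factors `1 *` let `integral_exp_mul_complexGaussian` evaluate every noise term in the same
  -- way.
  have hexp : ∀ z : (Fin N → ℂ) × ℂ × ℂ,
      Complex.exp (↑(inner ℝ (received w h s z) t) * Complex.I) =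
        Complex.exp (↑(inner ℝ (dotT h w * s) t) * Complex.I) *
        ((∏ i, Complex.exp (↑(inner ℝ (h i * z.1 i) t) * Complex.I)) *
          (Complex.exp (↑(inner ℝ (1 * z.2.1) t) * Complex.I) *
            Complex.exp (↑(inner ℝ (1 * z.2.2) t) * Complex.I))) := by
    intro z
    rw [← Complex.exp_sum, ← Complex.exp_add, ← Complex.exp_add, ← Complex.exp_add]
    congr 1
    have : received w h s z = dotT h w * s + (∑ i, h i * z.1 i) + z.2.1 + z.2.2 := by
      simp only [received, dotT, mul_add, Finset.sum_add_distrib, Finset.sum_mul, mul_assoc]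
    rw [this, inner_add_left, inner_add_left, inner_add_left, sum_inner, ← Finset.sum_mul]
    push_cast
    simp only [one_mul]
    ring
  simp_rw [hexp]
  rw [integral_const_mul]
  change _ * ∫ z, _ ∂((Measure.pi fun i => complexGaussian (D.κt * D.p * ‖w i‖₊ ^ 2)).prod
      ((complexGaussian D.σ2).prod (complexGaussian (D.κr * D.p * ‖dotT h w‖₊ ^ 2)))) = _
  rw [integral_prod_mul (fun z : Fin N → ℂ =>
      ∏ i, Complex.exp (↑(inner ℝ (h i * z i) t) * Complex.I))
      (fun z : ℂ × ℂ => Complex.exp (↑(inner ℝ (1 * z.1) t) * Complex.I) *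
            Complex.exp (↑(inner ℝ (1 * z.2) t) * Complex.I)),
    integral_prod_mul (fun z : ℂ => Complex.exp (↑(inner ℝ (1 * z) t) * Complex.I))
      (fun z : ℂ => Complex.exp (↑(inner ℝ (1 * z) t) * Complex.I)),
    integral_fintype_prod_eq_prod
      (fun i (z : ℂ) => Complex.exp (↑(inner ℝ (h i * z) t) * Complex.I))]
  simp only [integral_exp_mul_complexGaussian]
  rw [← Complex.exp_sum, ← Complex.exp_add, ← Complex.exp_add, ← Complex.exp_add,
    ← Complex.exp_add]
  congr 1
  rw [add_comm]
  congr 1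
  norm_cast
  rw [Finset.sum_neg_distrib, ← neg_add, ← neg_add, neg_inj]
  simp only [noiseVar]
  push_cast
  rw [add_mul, add_mul, Finset.sum_mul, add_div, add_div, Finset.sum_div, add_assoc]
  congr 1
  · exact Finset.sum_congr rfl fun i _ => by ring
  · simp

end ComplexGaussian

/-! ### Mutual information bounded by divergence from a reference channel -/

section Information

/-- Replacing the second marginal by another law does not decrease the divergence of a joint law
from the product of its marginals. -/
lemma klDiv_prod_marginals_le {α β : Type*} [MeasurableSpace α] [StandardBorelSpace α] [Nonempty α]
    [MeasurableSpace β] (ρ : Measure (α × β)) [IsProbabilityMeasure ρ] (ν : Measure β)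
    [IsProbabilityMeasure ν] :
    klDiv ρ ((ρ.map Prod.fst).prod (ρ.map Prod.snd)) ≤ klDiv ρ ((ρ.map Prod.fst).prod ν) := by
  have : IsProbabilityMeasure (ρ.map Prod.fst) := Measure.isProbabilityMeasure_map (by fun_prop)
  have : IsProbabilityMeasure (ρ.map Prod.snd) := Measure.isProbabilityMeasure_map (by fun_prop)
  -- The coordinates are swapped so that the marginal being replaced comes first in the chain rule.
  -- The disintegration then needs only `α` standard Borel, so the observation space can be
  -- arbitrary.
  set σ := ρ.map Prod.swap with hσ
  have : IsProbabilityMeasure σ := Measure.isProbabilityMeasure_map (by fun_prop)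
  have hfst : σ.fst = ρ.map Prod.snd := by
    rw [Measure.fst, hσ, Measure.map_map (by fun_prop) (by fun_prop)]
    rfl
  have hdis : ρ.map Prod.snd ⊗ₘ σ.condKernel = σ := by rw [← hfst, Measure.disintegrate]
  have hback : σ.map Prod.swap = ρ := by
    rw [hσ, Measure.map_map (by fun_prop) (by fun_prop)]
    simp
  have hconst : ∀ τ : Measure β, [IsProbabilityMeasure τ] →
      τ ⊗ₘ Kernel.const β (ρ.map Prod.fst) = ((ρ.map Prod.fst).prod τ).map Prod.swap := by
    intro τ _
    rw [Measure.compProd_const, Measure.prod_swap]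
  calc klDiv ρ ((ρ.map Prod.fst).prod (ρ.map Prod.snd))
      = klDiv (σ.map Prod.swap)
        (((ρ.map Prod.snd).prod (ρ.map Prod.fst)).map Prod.swap) := by
        rw [hback, Measure.prod_swap]
    _ ≤ klDiv σ ((ρ.map Prod.snd).prod (ρ.map Prod.fst)) := klDiv_map_le _ _ (by fun_prop)
    _ = klDiv (ρ.map Prod.snd ⊗ₘ σ.condKernel)
        (ρ.map Prod.snd ⊗ₘ Kernel.const β (ρ.map Prod.fst)) := by
        rw [hdis, Measure.compProd_const]
    _ ≤ klDiv (ρ.map Prod.snd ⊗ₘ σ.condKernel) (ν ⊗ₘ Kernel.const β (ρ.map Prod.fst)) := by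
        -- The discarded term is the divergence of the true second marginal from `ν`.
        rw [klDiv_compProd_eq_add (ρ.map Prod.snd) ν]
        exact le_add_self
    _ = klDiv (ρ.map Prod.swap) (((ρ.map Prod.fst).prod ν).map Prod.swap) := by
        rw [hdis, hconst]
    _ ≤ klDiv ρ ((ρ.map Prod.fst).prod ν) := klDiv_map_le _ _ (by fun_prop)

/-- The divergence of a measure with an everywhere positive density is the mean of the logarithm
of the density. -/
lemma klDiv_withDensity_exp {α : Type*} [MeasurableSpace α] {μ ν : Measure α}
    [IsProbabilityMeasure μ] [IsProbabilityMeasure ν] {L : α → ℝ} (hL : Measurable L)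
    (hμ : μ = ν.withDensity fun x => ENNReal.ofReal (Real.exp (L x))) (hint : Integrable L μ) :
    klDiv μ ν = ENNReal.ofReal (∫ x, L x ∂μ) := by
  have hac : μ ≪ ν := hμ ▸ withDensity_absolutelyContinuous _ _
  have hllr : llr μ ν =ᵐ[μ] L := by
    have h : μ.rnDeriv ν =ᵐ[ν] fun x => ENNReal.ofReal (Real.exp (L x)) := by
      rw [hμ]
      exact Measure.rnDeriv_withDensity _ (by fun_prop)
    filter_upwards [hac h] with x hx
    rw [llr, hx, ENNReal.toReal_ofReal (Real.exp_nonneg _), Real.log_exp]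
  rw [klDiv_of_ac_of_integrable hac ((integrable_congr hllr).2 hint), integral_congr_ae hllr]
  simp

/-- The mutual information between the data signal and the observations is at most the divergence
of the channel from a channel whose output does not depend on the data signal. -/
lemma klDiv_jointLaw_le {N : ℕ} {𝒰 : Type*} [MeasurableSpace 𝒰] (D : Downlink)
    (post : Measure (Vec N)) [IsProbabilityMeasure post] (side : Kernel (Vec N) 𝒰)
    [IsMarkovKernel side] (w : Vec N) (f : Measure ℂ) [IsProbabilityMeasure f]
    (q : Kernel (Vec N) ℂ) [IsMarkovKernel q] :
    klDiv (jointLaw D post side w f)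
        (((jointLaw D post side w f).map Prod.fst).prod ((jointLaw D post side w f).map Prod.snd))
      ≤ klDiv ((post.prod f) ⊗ₘ outputKernel D w)
        ((post.prod f) ⊗ₘ q.comap Prod.fst measurable_fst) := by
  set side' : Kernel (Vec N × ℂ) 𝒰 := side.comap Prod.fst measurable_fst with hside'
  set proj : (Vec N × ℂ) × (ℂ × 𝒰) → ℂ × ℂ × 𝒰 := fun x => (x.1.2, x.2) with hproj
  have hpm : Measurable proj := by fun_prop
  have hJ : jointLaw D post side w f = ((post.prod f) ⊗ₘ (outputKernel D w ×ₖ side')).map proj :=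
    rfl
  have : IsProbabilityMeasure (jointLaw D post side w f) := by
    rw [hJ]
    exact Measure.isProbabilityMeasure_map hpm.aemeasurable
  set ν : Measure (ℂ × 𝒰) := (post ⊗ₘ (q ×ₖ side)).map Prod.snd with hν
  have : IsProbabilityMeasure ν := Measure.isProbabilityMeasure_map (by fun_prop)
  have hfst : (jointLaw D post side w f).map Prod.fst = f := by
    rw [hJ, Measure.map_map (by fun_prop) hpm]
    have : Prod.fst ∘ proj = Prod.snd ∘ (Prod.fst : (Vec N × ℂ) × (ℂ × 𝒰) → Vec N × ℂ) := rfl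
    rw [this, ← Measure.map_map (by fun_prop) (by fun_prop), ← Measure.fst, Measure.fst_compProd]
    simp
  -- Neither `q` nor `side` sees the signal, so the reference law makes `s` independent of `(y, u)`.
  have href : ((post.prod f) ⊗ₘ ((q.comap Prod.fst measurable_fst) ×ₖ side')).map proj =
      f.prod ν := by
    symm
    refine Measure.prod_eq fun s t hs ht => ?_
    have hk : Measurable fun h => (q ×ₖ side) h t := Kernel.measurable_coe _ ht
    have hpre : proj ⁻¹' (s ×ˢ t) = (Set.univ ×ˢ s) ×ˢ t := by
      ext x
      simp [hproj]
    have hcomp : (q.comap Prod.fst measurable_fst) ×ₖ side' =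
        (q ×ₖ side).comap (Prod.fst : Vec N × ℂ → Vec N) measurable_fst := by
      ext1 x
      simp [Kernel.prod_apply, hside', Kernel.comap_apply]
    rw [Measure.map_apply hpm (hs.prod ht), hpre, hcomp,
      Measure.compProd_apply_prod (MeasurableSet.univ.prod hs) ht, ← Measure.prod_restrict,
      Measure.restrict_univ]
    simp only [Kernel.comap_apply]
    have hk' : AEMeasurable (fun a : Vec N × ℂ => (q ×ₖ side) a.1 t) (post.prod (f.restrict s)) :=
      (hk.comp measurable_fst).aemeasurable
    rw [lintegral_prod _ hk', hν,
      Measure.map_apply (by fun_prop) ht, Measure.compProd_apply (measurable_snd ht)]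
    simp only [lintegral_const, Measure.restrict_apply_univ]
    rw [lintegral_mul_const _ hk, mul_comm]
    rfl
  have hassoc : ∀ κ : Kernel (Vec N × ℂ) ℂ, [IsMarkovKernel κ] →
      (post.prod f) ⊗ₘ (κ ×ₖ side') =
        (((post.prod f) ⊗ₘ κ) ⊗ₘ side'.comap Prod.fst measurable_fst).map
          MeasurableEquiv.prodAssoc := by
    intro κ _
    rw [Measure.compProd_assoc']
    congr 1
    ext x t ht
    rw [Kernel.compProd_apply ht, Kernel.prod_apply, Measure.prod_apply ht]
    rfl
  calc _ ≤ klDiv (jointLaw D post side w f) (f.prod ν) := by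
        have h := klDiv_prod_marginals_le (jointLaw D post side w f) ν
        rwa [hfst] at h ⊢
    -- Data processing: forgetting `h` does not increase the divergence.
    _ ≤ klDiv ((post.prod f) ⊗ₘ (outputKernel D w ×ₖ side'))
        ((post.prod f) ⊗ₘ ((q.comap Prod.fst measurable_fst) ×ₖ side')) := by
        rw [← href, hJ]
        exact klDiv_map_le _ _ hpm
    _ ≤ klDiv (((post.prod f) ⊗ₘ outputKernel D w) ⊗ₘ side'.comap Prod.fst measurable_fst)
        (((post.prod f) ⊗ₘ q.comap Prod.fst measurable_fst) ⊗ₘ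
          side'.comap Prod.fst measurable_fst) := by
        rw [hassoc, hassoc]
        exact klDiv_map_le _ _ (by fun_prop)
    -- The side information is generated by the same kernel in both laws, so it contributes no
    -- divergence.
    _ = _ := klDiv_compProd_left _ _ _

end Information

/-! ### Cauchy–Schwarz over beamformers, and the Gaussian log-likelihood ratio -/

section Divergence

/-- The supremum of the signal to transmit-distortion-plus-noise ratio over all unit-norm
beamforming vectors, for a given channel realization. -/
def sinrBound {N : ℕ} (D : Downlink) (h : Vec N) : ℝ :=
  ∑ i, D.p * ‖h i‖ ^ 2 / (D.κt * D.p * ‖h i‖ ^ 2 + D.σ2)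

lemma measurable_sinrBound {N : ℕ} (D : Downlink) : Measurable (sinrBound (N := N) D) := by
  unfold sinrBound
  fun_prop

lemma sinrBound_nonneg {N : ℕ} (D : Downlink) (h : Vec N) : 0 ≤ sinrBound D h :=
  Finset.sum_nonneg fun i _ => by positivity

/-- Distortion grows with the signal power, so each antenna contributes at most `1 / κt`. This gives
integrability of the rate under any law of `h`. -/
lemma sinrBound_le {N : ℕ} {D : Downlink} (hσ : 0 < D.σ2) (hκt : 0 < D.κt) (h : Vec N) :
    sinrBound D h ≤ N / D.κt := by
  have hσ' : (0 : ℝ) < D.σ2 := hσ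
  have hκ' : (0 : ℝ) < D.κt := hκt
  calc sinrBound D h ≤ ∑ _i : Fin N, 1 / (D.κt : ℝ) := by
        refine Finset.sum_le_sum fun i _ => ?_
        rw [div_le_div_iff₀ (by positivity) hκ']
        nlinarith
    _ = N / D.κt := by simp [div_eq_mul_inv]

/-- Cauchy–Schwarz with weights `d i = κt p |h i|² + σ2`, splitting `h i * w i` into `h i / √(d i)`
and `√(d i) * w i`. The unit norm of `w` turns the weighted sum into the transmit distortion plus
`σ2`. -/
lemma sq_norm_dotT_le {N : ℕ} {D : Downlink} (hσ : 0 < D.σ2) (h : Vec N) {w : Vec N}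
    (hw : ‖w‖ = 1) :
    D.p * ‖dotT h w‖ ^ 2 ≤
      sinrBound D h * ((∑ i, (D.κt * D.p * ‖w i‖ ^ 2 * ‖h i‖ ^ 2 : ℝ)) + D.σ2) := by
  have hσ' : (0 : ℝ) < D.σ2 := hσ
  have hw1 : ∑ i, ‖w i‖ ^ 2 = 1 := by rw [← EuclideanSpace.norm_sq_eq, hw, one_pow]
  have hcs : (∑ i, ‖h i‖ * ‖w i‖) ^ 2 ≤
      (∑ i, ‖h i‖ ^ 2 / (D.κt * D.p * ‖h i‖ ^ 2 + D.σ2)) *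
        ∑ i, (D.κt * D.p * ‖h i‖ ^ 2 + D.σ2) * ‖w i‖ ^ 2 := by
    refine Finset.sum_sq_le_sum_mul_sum_of_sq_le_mul _ (fun i _ => by positivity)
      (fun i _ => by positivity) fun i _ => le_of_eq ?_
    have : (0 : ℝ) < D.κt * D.p * ‖h i‖ ^ 2 + D.σ2 := by positivity
    field_simp
  have hn : ‖dotT h w‖ ≤ ∑ i, ‖h i‖ * ‖w i‖ :=
    (norm_sum_le _ _).trans (Finset.sum_le_sum fun i _ => (norm_mul _ _).le)
  have hsum : ∑ i, (D.κt * D.p * ‖h i‖ ^ 2 + D.σ2) * ‖w i‖ ^ 2 =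
      (∑ i, (D.κt * D.p * ‖w i‖ ^ 2 * ‖h i‖ ^ 2 : ℝ)) + D.σ2 := by
    conv_rhs => rw [← mul_one (D.σ2 : ℝ), ← hw1, Finset.mul_sum, ← Finset.sum_add_distrib]
    exact Finset.sum_congr rfl fun i _ => by ring
  rw [hsum] at hcs
  calc (D.p : ℝ) * ‖dotT h w‖ ^ 2 ≤ (D.p : ℝ) * (∑ i, ‖h i‖ * ‖w i‖) ^ 2 := by gcongr
    _ ≤ _ := mul_le_mul_of_nonneg_left hcs D.p.2
    _ = _ := by
      rw [← mul_assoc, Finset.mul_sum]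
      simp only [sinrBound, mul_div_assoc]

/-- The rate function `log (1 + x / (1 + κr x))` in nats. -/
def rate (D : Downlink) (x : ℝ) : ℝ := Real.log (1 + x / (1 + D.κr * x))

lemma rate_nonneg (D : Downlink) {x : ℝ} (hx : 0 ≤ x) : 0 ≤ rate D x :=
  Real.log_nonneg (le_add_of_nonneg_right (by positivity))

lemma measurable_rate (D : Downlink) : Measurable (rate D) := by
  unfold rate
  fun_prop

/-- The graph of the rate function is below its tangents. -/
lemma rate_le_tangent (D : Downlink) {x g : ℝ} (hx : 0 ≤ x) (hg : 0 ≤ g) :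
    rate D x ≤ rate D g + (x - g) / ((1 + g + D.κr * g) * (1 + D.κr * g)) := by
  have hk : (0 : ℝ) ≤ D.κr := D.κr.2
  have h1 : 0 < 1 + D.κr * x := by positivity
  have h2 : 0 < 1 + D.κr * g := by positivity
  have h3 : 0 < 1 + g + D.κr * g := by positivity
  have h4 : 0 < 1 + x + D.κr * x := by positivity
  have e1 : 1 + x / (1 + D.κr * x) = (1 + x + D.κr * x) / (1 + D.κr * x) := by
    field_simp
    ring
  have e2 : 1 + g / (1 + D.κr * g) = (1 + g + D.κr * g) / (1 + D.κr * g) := by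
    field_simp
    ring
  rw [rate, rate, e1, e2, ← sub_le_iff_le_add', ← Real.log_div (by positivity) (by positivity)]
  refine (Real.log_le_sub_one_of_pos (by positivity)).trans ?_
  have e3 : (1 + x + D.κr * x) / (1 + D.κr * x) / ((1 + g + D.κr * g) / (1 + D.κr * g)) - 1 =
      (x - g) / ((1 + g + D.κr * g) * (1 + D.κr * x)) := by
    field_simp
    ring
  -- Replacing `1 + κr x` by `1 + κr g` in the denominator costs a nonnegative multiple of `κr (x -
  -- g)²`; the resulting slope is the derivative of `rate` at `g`.
  rw [e3, div_le_div_iff₀ (by positivity) (by positivity)]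
  nlinarith [mul_nonneg (mul_nonneg h3.le hk) (sq_nonneg (x - g))]

/-- The conditional variance of the received signal given the channel `h` only. -/
def outputVar {N : ℕ} (D : Downlink) (w h : Vec N) : ℝ≥0 :=
  noiseVar D w h + D.p * ‖dotT h w‖₊ ^ 2

lemma measurable_dotT {N : ℕ} (w : Vec N) : Measurable fun h => dotT h w := by
  unfold dotT
  fun_prop

lemma measurable_noiseVar {N : ℕ} (D : Downlink) (w : Vec N) : Measurable (noiseVar D w) := by
  unfold noiseVar
  have := measurable_dotT w
  fun_prop

lemma measurable_outputVar {N : ℕ} (D : Downlink) (w : Vec N) : Measurable (outputVar D w) := by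
  unfold outputVar
  have := measurable_dotT w
  have := measurable_noiseVar D w
  fun_prop

lemma noiseVar_pos {N : ℕ} {D : Downlink} (hσ : 0 < D.σ2) (w h : Vec N) : 0 < noiseVar D w h := by
  unfold noiseVar
  positivity

lemma outputVar_pos {N : ℕ} {D : Downlink} (hσ : 0 < D.σ2) (w h : Vec N) :
    0 < outputVar D w h :=
  (noiseVar_pos hσ w h).trans_le le_self_add

lemma coe_outputVar {N : ℕ} (D : Downlink) (w h : Vec N) :
    (outputVar D w h : ℝ) = noiseVar D w h + D.p * ‖dotT h w‖ ^ 2 := by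
  simp [outputVar]

lemma log_outputVar_div_noiseVar_nonneg {N : ℕ} {D : Downlink} (hσ : 0 < D.σ2) (w h : Vec N) :
    0 ≤ Real.log (outputVar D w h / noiseVar D w h) := by
  have hc : (0 : ℝ) < noiseVar D w h := noiseVar_pos hσ w h
  refine Real.log_nonneg ((one_le_div hc).2 ?_)
  rw [coe_outputVar]
  have : (0 : ℝ) ≤ D.p := D.p.2
  exact le_add_of_nonneg_right (by positivity)

lemma log_outputVar_div_noiseVar_le {N : ℕ} {D : Downlink} (hσ : 0 < D.σ2) {w : Vec N}
    (hw : ‖w‖ = 1) (h : Vec N) :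
    Real.log (outputVar D w h / noiseVar D w h) ≤ rate D (sinrBound D h) := by
  have hc : (0 : ℝ) < noiseVar D w h := noiseVar_pos hσ w h
  have hv : (0 : ℝ) < outputVar D w h := outputVar_pos hσ w h
  have hG := sinrBound_nonneg D h
  have hle := sq_norm_dotT_le hσ h hw
  have hk : (0 : ℝ) ≤ D.κr := D.κr.2
  rw [rate]
  refine Real.log_le_log (by positivity) ?_
  rw [coe_outputVar, add_div, div_self hc.ne', add_le_add_iff_left,
    div_le_div_iff₀ hc (by positivity)]
  have : (noiseVar D w h : ℝ) = ((∑ i, (D.κt * D.p * ‖w i‖ ^ 2 * ‖h i‖ ^ 2 : ℝ)) + D.σ2) +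
      D.κr * D.p * ‖dotT h w‖ ^ 2 := by
    simp [noiseVar]
  rw [this]
  -- After cross-multiplication the terms containing `κr` cancel, and exactly `hle` remains.
  nlinarith

/-- The `CN(0, E|y|²)` channel whose output does not depend on the data signal. -/
def refKernel {N : ℕ} (D : Downlink) (w : Vec N) : Kernel (Vec N) ℂ :=
  complexGaussianKernel.comap (outputVar D w) (measurable_outputVar D w)

instance {N : ℕ} (D : Downlink) (w : Vec N) : IsMarkovKernel (refKernel D w) := by
  unfold refKernel
  infer_instance

/-- The log-likelihood ratio of the channel to the reference channel. -/
def logRatio {N : ℕ} (D : Downlink) (w : Vec N) (x : (Vec N × ℂ) × ℂ) : ℝ :=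
  Real.log (outputVar D w x.1.1 / noiseVar D w x.1.1) + ‖x.2‖ ^ 2 / outputVar D w x.1.1 -
    ‖x.2 - dotT x.1.1 w * x.1.2‖ ^ 2 / noiseVar D w x.1.1

lemma measurable_logRatio {N : ℕ} (D : Downlink) (w : Vec N) : Measurable (logRatio D w) := by
  unfold logRatio
  have := measurable_dotT w
  have := measurable_noiseVar D w
  have := measurable_outputVar D w
  fun_prop

lemma outputKernel_eq_withDensity {N : ℕ} {D : Downlink} (hσ : 0 < D.σ2) (w : Vec N) :
    outputKernel D w = ((refKernel D w).comap Prod.fst measurable_fst).withDensity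
      fun x y => ENNReal.ofReal (Real.exp (logRatio D w (x, y))) := by
  have hm := measurable_logRatio D w
  ext1 x
  obtain ⟨h, s⟩ := x
  have hc := noiseVar_pos hσ w h
  have hv := outputVar_pos hσ w h
  have hc' : (0 : ℝ) < noiseVar D w h := hc
  have hv' : (0 : ℝ) < outputVar D w h := hv
  rw [Kernel.withDensity_apply _ (by unfold Function.uncurry; fun_prop), outputKernel_apply,
    map_add_complexGaussian_eq_withDensity hc, Kernel.comap_apply]
  change _ = (complexGaussian (outputVar D w h)).withDensity _
  rw [complexGaussian_eq_withDensity hv, ← withDensity_mul _ (by unfold gaussianDensity; fun_prop)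
    (by fun_prop)]
  congr 1
  funext y
  simp only [Pi.mul_apply]
  rw [← ENNReal.ofReal_mul (gaussianDensity_pos hv _ _).le]
  congr 1
  have e : logRatio D w ((h, s), y) = Real.log (outputVar D w h / noiseVar D w h) +
      (‖y‖ ^ 2 / outputVar D w h + -(‖y - dotT h w * s‖ ^ 2 / noiseVar D w h)) := by
    rw [logRatio]
    ring
  rw [e, Real.exp_add, Real.exp_add, Real.exp_log (by positivity), gaussianDensity,
    gaussianDensity, sub_zero]
  have e2 : Real.exp (-(‖y‖ ^ 2 / outputVar D w h)) * Real.exp (‖y‖ ^ 2 / outputVar D w h) = 1 := by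
    rw [← Real.exp_add, neg_add_cancel, Real.exp_zero]
  set E := Real.exp (-(‖y - dotT h w * s‖ ^ 2 / noiseVar D w h))
  calc (Real.pi * noiseVar D w h : ℝ)⁻¹ * E
      = (Real.pi * outputVar D w h : ℝ)⁻¹ * (outputVar D w h / noiseVar D w h) * E *
        (Real.exp (-(‖y‖ ^ 2 / outputVar D w h)) * Real.exp (‖y‖ ^ 2 / outputVar D w h)) := by
        rw [e2]
        field_simp
    _ = _ := by ring

end Divergence

/-! ### Bounding the divergence, the block capacity and its mean -/

section BlockCapacity

variable {N : ℕ} {D : Downlink}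

lemma integrable_sq_norm_sub_outputKernel (w h : Vec N) (s a : ℂ) :
    Integrable (fun y => ‖y - a‖ ^ 2) (outputKernel D w (h, s)) := by
  rw [outputKernel_apply, integrable_map_measure (Measurable.aestronglyMeasurable (by fun_prop))
    (by fun_prop)]
  refine (integrable_sq_norm_add_complexGaussian (noiseVar D w h) (dotT h w * s - a)).congr
    (ae_of_all _ fun z => ?_)
  simp only [Function.comp_apply]
  ring_nf

lemma integral_sq_norm_sub_outputKernel (w h : Vec N) (s a : ℂ) :
    ∫ y, ‖y - a‖ ^ 2 ∂(outputKernel D w (h, s)) = ‖dotT h w * s - a‖ ^ 2 + noiseVar D w h := by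
  rw [outputKernel_apply, integral_map (by fun_prop) (Measurable.aestronglyMeasurable
    (by fun_prop)), ← integral_sq_norm_add_complexGaussian (noiseVar D w h) (dotT h w * s - a)]
  refine integral_congr_ae (ae_of_all _ fun z => ?_)
  simp only
  ring_nf

lemma integral_sq_norm_outputKernel_div (w h : Vec N) (s : ℂ) :
    ∫ y, ‖y‖ ^ 2 / outputVar D w h ∂(outputKernel D w (h, s)) =
      (‖dotT h w‖ ^ 2 * ‖s‖ ^ 2 + noiseVar D w h) / outputVar D w h := by
  rw [integral_div]
  have := integral_sq_norm_sub_outputKernel (D := D) w h s 0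
  simp only [sub_zero, norm_mul, mul_pow] at this
  rw [this]

lemma integral_sq_norm_noise_div (hσ : 0 < D.σ2) (w h : Vec N) (s : ℂ) :
    ∫ y, ‖y - dotT h w * s‖ ^ 2 / noiseVar D w h ∂(outputKernel D w (h, s)) = 1 := by
  have hc : (0 : ℝ) < noiseVar D w h := noiseVar_pos hσ w h
  rw [integral_div, integral_sq_norm_sub_outputKernel]
  simp [hc.ne']

lemma rate_sinrBound_le (hσ : 0 < D.σ2) (hκt : 0 < D.κt) (h : Vec N) :
    rate D (sinrBound D h) ≤ N / D.κt := by
  -- The tangent at `0` has slope one, hence `rate D x ≤ x`.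
  have := rate_le_tangent D (sinrBound_nonneg D h) le_rfl
  simp only [rate, add_zero, Real.log_one, mul_zero, sub_zero, mul_one, div_one,
    zero_add] at this ⊢
  exact this.trans (sinrBound_le hσ hκt h)

lemma integrable_log_outputVar_div (hσ : 0 < D.σ2) (hκt : 0 < D.κt) {w : Vec N} (hw : ‖w‖ = 1)
    {α : Type*} [MeasurableSpace α] (μ : Measure α) [IsFiniteMeasure μ] {g : α → Vec N}
    (hg : Measurable g) :
    Integrable (fun x => Real.log (outputVar D w (g x) / noiseVar D w (g x))) μ := by
  have h1 := (measurable_noiseVar D w).comp hg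
  have h2 := (measurable_outputVar D w).comp hg
  simp only [Function.comp_def] at h1 h2
  refine Integrable.of_bound (Measurable.aestronglyMeasurable (by fun_prop))
    (N / D.κt : ℝ) (ae_of_all _ fun x => ?_)
  rw [Real.norm_of_nonneg (log_outputVar_div_noiseVar_nonneg hσ w _)]
  exact (log_outputVar_div_noiseVar_le hσ hw _).trans (rate_sinrBound_le hσ hκt _)

lemma integrable_rate_sinrBound (hσ : 0 < D.σ2) (hκt : 0 < D.κt)
    (μ : Measure (Vec N)) [IsFiniteMeasure μ] :
    Integrable (fun h => rate D (sinrBound D h)) μ := by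
  refine Integrable.of_bound
    ((measurable_rate D).comp (measurable_sinrBound D)).aestronglyMeasurable
    (N / D.κt : ℝ) (ae_of_all _ fun x => ?_)
  rw [Real.norm_of_nonneg (rate_nonneg D (sinrBound_nonneg D x))]
  exact rate_sinrBound_le hσ hκt x

lemma integrable_sq_norm_signal {f : Measure ℂ} (hf : ∫⁻ s, ‖s‖ₑ ^ 2 ∂f ≤ D.p) :
    Integrable (fun s : ℂ => ‖s‖ ^ 2) f := by
  refine ⟨Measurable.aestronglyMeasurable (by fun_prop), ?_⟩
  rw [hasFiniteIntegral_iff_enorm]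
  refine lt_of_le_of_lt ?_ (hf.trans_lt ENNReal.coe_lt_top)
  simp

lemma integral_sq_norm_signal_le {f : Measure ℂ} (hf : ∫⁻ s, ‖s‖ₑ ^ 2 ∂f ≤ D.p) :
    ∫ s, ‖s‖ ^ 2 ∂f ≤ D.p := by
  rw [integral_eq_lintegral_of_nonneg_ae (ae_of_all _ fun s => by positivity)
    (Measurable.aestronglyMeasurable (by fun_prop))]
  refine ENNReal.toReal_le_of_le_ofReal D.p.2 ?_
  refine le_trans (lintegral_mono fun s => ?_) (hf.trans (by simp))
  rw [← ofReal_norm, ENNReal.ofReal_pow (norm_nonneg _)]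

/-- The bound is free of `h`, so the output-power term is integrable without any moment assumption
on `post`. -/
lemma output_power_ratio_le (hp : 0 < D.p) (hσ : 0 < D.σ2) (w h : Vec N) (s : ℂ) :
    (‖dotT h w‖ ^ 2 * ‖s‖ ^ 2 + noiseVar D w h) / outputVar D w h ≤ 1 + ‖s‖ ^ 2 / D.p := by
  have hp' : (0 : ℝ) < D.p := hp
  have hv : (0 : ℝ) < outputVar D w h := outputVar_pos hσ w h
  have hc : (0 : ℝ) < noiseVar D w h := noiseVar_pos hσ w h
  rw [div_le_iff₀ hv, coe_outputVar]
  have e : (1 + ‖s‖ ^ 2 / D.p) * (noiseVar D w h + D.p * ‖dotT h w‖ ^ 2) =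
      (‖dotT h w‖ ^ 2 * ‖s‖ ^ 2 + noiseVar D w h) +
        (D.p * ‖dotT h w‖ ^ 2 + ‖s‖ ^ 2 / D.p * noiseVar D w h) := by
    field_simp
    ring
  rw [e]
  exact le_add_of_nonneg_right (by positivity)

lemma integrable_logRatio (hp : 0 < D.p) (hσ : 0 < D.σ2) (hκt : 0 < D.κt)
    {w : Vec N} (hw : ‖w‖ = 1) (post : Measure (Vec N)) [IsProbabilityMeasure post]
    (f : Measure ℂ) [IsProbabilityMeasure f] (hf : ∫⁻ s, ‖s‖ₑ ^ 2 ∂f ≤ D.p) :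
    Integrable (logRatio D w) ((post.prod f) ⊗ₘ outputKernel D w) := by
  have h1 := measurable_dotT w
  have h2 := measurable_noiseVar D w
  have h3 := measurable_outputVar D w
  have i1 : Integrable (fun x : (Vec N × ℂ) × ℂ => ‖x.2‖ ^ 2 / (outputVar D w x.1.1 : ℝ))
      ((post.prod f) ⊗ₘ outputKernel D w) := by
    rw [Measure.integrable_compProd_iff (Measurable.aestronglyMeasurable (by fun_prop))]
    constructor
    · refine ae_of_all _ fun x => ?_
      have := integrable_sq_norm_sub_outputKernel (D := D) w x.1 x.2 0
      simp only [sub_zero] at this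
      exact this.div_const (outputVar D w x.1 : ℝ)
    · have e : ∀ x : Vec N × ℂ, ∫ y : ℂ, ‖‖y‖ ^ 2 / (outputVar D w x.1 : ℝ)‖ ∂(outputKernel D w x) =
          (‖dotT x.1 w‖ ^ 2 * ‖x.2‖ ^ 2 + noiseVar D w x.1) / outputVar D w x.1 := by
        intro x
        rw [← integral_sq_norm_outputKernel_div]
        exact integral_congr_ae (ae_of_all _ fun y => Real.norm_of_nonneg (by positivity))
      simp only [e]
      refine Integrable.mono' (g := fun x : Vec N × ℂ => 1 + ‖x.2‖ ^ 2 / (D.p : ℝ))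
        ((integrable_const _).add (((integrable_sq_norm_signal hf).comp_snd _).div_const _))
        (Measurable.aestronglyMeasurable (by fun_prop)) (ae_of_all _ fun x => ?_)
      rw [Real.norm_of_nonneg (by positivity)]
      exact output_power_ratio_le hp hσ w _ _
  have i2 : Integrable (fun x : (Vec N × ℂ) × ℂ =>
      ‖x.2 - dotT x.1.1 w * x.1.2‖ ^ 2 / (noiseVar D w x.1.1 : ℝ))
      ((post.prod f) ⊗ₘ outputKernel D w) := by
    rw [Measure.integrable_compProd_iff (Measurable.aestronglyMeasurable (by fun_prop))]
    constructor
    · exact ae_of_all _ fun x => (integrable_sq_norm_sub_outputKernel (D := D) w x.1 x.2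
        (dotT x.1 w * x.2)).div_const (noiseVar D w x.1 : ℝ)
    · have e : ∀ x : Vec N × ℂ,
          ∫ y : ℂ, ‖‖y - dotT x.1 w * x.2‖ ^ 2 / (noiseVar D w x.1 : ℝ)‖ ∂(outputKernel D w x) =
          1 := by
        intro x
        rw [← integral_sq_norm_noise_div hσ w x.1 x.2]
        exact integral_congr_ae (ae_of_all _ fun y => Real.norm_of_nonneg (by positivity))
      simp only [e]
      exact integrable_const _
  exact ((integrable_log_outputVar_div hσ hκt hw _ (measurable_fst.comp measurable_fst)).add
    i1).sub i2

lemma integral_logRatio_outputKernel (hσ : 0 < D.σ2) (w h : Vec N) (s : ℂ) :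
    ∫ y, logRatio D w ((h, s), y) ∂(outputKernel D w (h, s)) =
      Real.log (outputVar D w h / noiseVar D w h) +
        (‖dotT h w‖ ^ 2 * ‖s‖ ^ 2 + noiseVar D w h) / outputVar D w h - 1 := by
  have i1 := (integrable_sq_norm_sub_outputKernel (D := D) w h s 0).div_const (outputVar D w h : ℝ)
  have i2 := (integrable_sq_norm_sub_outputKernel (D := D) w h s (dotT h w * s)).div_const
    (noiseVar D w h : ℝ)
  simp only [sub_zero] at i1
  have i3 : Integrable (fun y : ℂ => Real.log (outputVar D w h / noiseVar D w h) +
      ‖y‖ ^ 2 / outputVar D w h) (outputKernel D w (h, s)) := (integrable_const _).add i1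
  simp only [logRatio]
  rw [integral_sub i3 i2, integral_add (integrable_const _) i1,
    integral_sq_norm_outputKernel_div, integral_sq_norm_noise_div hσ]
  simp

lemma integral_logRatio_le (hp : 0 < D.p) (hσ : 0 < D.σ2) (hκt : 0 < D.κt)
    {w : Vec N} (hw : ‖w‖ = 1) (post : Measure (Vec N)) [IsProbabilityMeasure post]
    (f : Measure ℂ) [IsProbabilityMeasure f] (hf : ∫⁻ s, ‖s‖ₑ ^ 2 ∂f ≤ D.p) :
    ∫ x, logRatio D w x ∂((post.prod f) ⊗ₘ outputKernel D w) ≤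
      ∫ h, rate D (sinrBound D h) ∂post := by
  have hint := integrable_logRatio hp hσ hκt hw post f hf
  have hint2 : Integrable (fun x => ∫ y, logRatio D w (x, y) ∂(outputKernel D w x))
      (post.prod f) := hint.integral_compProd
  have hs := integrable_sq_norm_signal hf
  rw [Measure.integral_compProd hint, integral_prod _ hint2]
  refine integral_mono hint2.integral_prod_left (integrable_rate_sinrBound hσ hκt post)
    fun h => ?_
  have hv : (0 : ℝ) < outputVar D w h := outputVar_pos hσ w h
  have hi : Integrable (fun s : ℂ => (‖dotT h w‖ ^ 2 * ‖s‖ ^ 2 + noiseVar D w h) /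
      outputVar D w h) f := ((hs.const_mul _).add (integrable_const _)).div_const _
  have hi' : Integrable (fun s : ℂ => Real.log (outputVar D w h / noiseVar D w h) +
      (‖dotT h w‖ ^ 2 * ‖s‖ ^ 2 + noiseVar D w h) / outputVar D w h) f :=
    (integrable_const _).add hi
  simp only [integral_logRatio_outputKernel hσ]
  rw [integral_sub hi' (integrable_const _), integral_add (integrable_const _) hi, integral_div,
    integral_add (hs.const_mul _) (integrable_const _), integral_const_mul]
  simp only [integral_const, probReal_univ, one_smul]
  refine le_trans ?_ (log_outputVar_div_noiseVar_le hσ hw h)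
  -- The reference variance is the output power at full signal power `p`. Hence this ratio is at
  -- most the `1` subtracted by the noise term.
  have : (‖dotT h w‖ ^ 2 * ∫ s, ‖s‖ ^ 2 ∂f + noiseVar D w h) / outputVar D w h ≤ 1 := by
    rw [div_le_one hv, coe_outputVar, add_comm, mul_comm (D.p : ℝ)]
    gcongr
    exact integral_sq_norm_signal_le hf
  linarith

lemma klDiv_outputKernel_le (hp : 0 < D.p) (hσ : 0 < D.σ2) (hκt : 0 < D.κt)
    {w : Vec N} (hw : ‖w‖ = 1) (post : Measure (Vec N)) [IsProbabilityMeasure post]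
    (f : Measure ℂ) [IsProbabilityMeasure f] (hf : ∫⁻ s, ‖s‖ₑ ^ 2 ∂f ≤ D.p) :
    klDiv ((post.prod f) ⊗ₘ outputKernel D w)
        ((post.prod f) ⊗ₘ (refKernel D w).comap Prod.fst measurable_fst) ≤
      ∫⁻ h, ENNReal.ofReal (rate D (sinrBound D h)) ∂post := by
  have hm := measurable_logRatio D w
  have hk := outputKernel_eq_withDensity hσ w
  -- `Measure.compProd_withDensity` needs the kernel with density to be s-finite; this is
  -- transported from `outputKernel` along `hk`.
  have hsf : ∀ κ : Kernel (Vec N × ℂ) ℂ, outputKernel D w = κ → IsSFiniteKernel κ :=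
    fun κ hκ => hκ ▸ inferInstance
  have := hsf _ hk
  rw [klDiv_withDensity_exp hm _ (integrable_logRatio hp hσ hκt hw post f hf),
    ← ofReal_integral_eq_lintegral_ofReal (integrable_rate_sinrBound hσ hκt post)
      (ae_of_all _ fun h => rate_nonneg D (sinrBound_nonneg D h))]
  · exact ENNReal.ofReal_le_ofReal (integral_logRatio_le hp hσ hκt hw post f hf)
  · conv_lhs => rw [hk]
    exact Measure.compProd_withDensity (by unfold Function.uncurry; fun_prop)

lemma blockCapacity_le (hp : 0 < D.p) (hσ : 0 < D.σ2) (hκt : 0 < D.κt)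
    {𝒰 : Type*} [MeasurableSpace 𝒰] (post : Kernel (Vec N) (Vec N)) [IsMarkovKernel post]
    (side : Kernel (Vec N × Vec N × Vec N) 𝒰) [IsMarkovKernel side] (e : Vec N) :
    blockCapacity D post side e ≤
      (∫⁻ h, ENNReal.ofReal (rate D (sinrBound D h)) ∂(post e)) / ENNReal.ofReal (Real.log 2) := by
  refine iSup_le fun w => iSup_le fun hw => iSup_le fun f => iSup_le fun hf => ?_
  refine ENNReal.div_le_div_right ?_ _
  exact (klDiv_jointLaw_le D (post e) _ w (f : Measure ℂ) (refKernel D w)).trans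
    (klDiv_outputKernel_le hp hσ hκt hw (post e) f hf)

lemma capacity_le_lintegral (hp : 0 < D.p) (hσ : 0 < D.σ2) (hκt : 0 < D.κt)
    {Ω : Type*} [MeasurableSpace Ω] (P : Measure Ω) [IsProbabilityMeasure P]
    {h est : Ω → Vec N} (hh : Measurable h) (hest : Measurable est)
    {𝒰 : Type*} [MeasurableSpace 𝒰]
    (side : Kernel (Vec N × Vec N × Vec N) 𝒰) [IsMarkovKernel side] :
    capacity D P h est side ≤
      (∫⁻ x, ENNReal.ofReal (rate D (sinrBound D x)) ∂(P.map h)) /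
        ENNReal.ofReal (Real.log 2) := by
  have hm : Measurable fun x : Vec N => ENNReal.ofReal (rate D (sinrBound D x)) :=
    ((measurable_rate D).comp (measurable_sinrBound D)).ennreal_ofReal
  have hm2 : Measurable fun e =>
      ∫⁻ x, ENNReal.ofReal (rate D (sinrBound D x)) ∂(condDistrib h est P e) :=
    hm.lintegral_kernel
  rw [capacity, outerExpectation]
  -- The bound on the block capacity is a measurable function of the estimate, so it serves as
  -- majorant in the outer expectation. Its integral collapses by the tower property.
  refine iInf_le_of_le _ (iInf_le_of_le (hm2.div_const (ENNReal.ofReal (Real.log 2)))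
    (iInf_le_of_le (fun e => blockCapacity_le hp hσ hκt _ side e) ?_))
  simp only [div_eq_mul_inv]
  rw [lintegral_mul_const _ hm2, ← Measure.lintegral_bind (Kernel.aemeasurable _) hm.aemeasurable,
    condDistrib_comp_map hest.aemeasurable hh.aemeasurable]

end BlockCapacity

/-! ### The exponential integral and the mean of the SINR bound -/

section ExpIntegral

lemma expIntegralE1_eq_integral_Ioi {r x : ℝ} (hr : 0 < r) (hx : 0 < x) :
    expIntegralE1 x * Real.exp x =
      ∫ ρ in Set.Ioi (0 : ℝ), 2 * ρ / r * Real.exp (-(ρ ^ 2 / r)) / (ρ ^ 2 / r + x) := by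
  -- The substitution `t = u ρ` gives `t x = ρ² / r + x`; the factor `exp x` then removes the shift.
  set u : ℝ → ℝ := fun ρ => 1 + ρ ^ 2 / (r * x) with hu
  have hmono : StrictMonoOn u (Set.Ioi 0) := by
    intro a ha b hb hab
    have ha' : (0 : ℝ) < a := ha
    simp only [hu]
    gcongr
  have himg : u '' Set.Ioi 0 = Set.Ioi 1 := by
    ext y
    simp only [Set.mem_image, Set.mem_Ioi, hu]
    constructor
    · rintro ⟨ρ, hρ, rfl⟩
      exact lt_add_of_pos_right _ (by positivity)
    · intro hy
      have : 0 < (y - 1) * (r * x) := mul_pos (sub_pos.2 hy) (by positivity)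
      refine ⟨√((y - 1) * (r * x)), Real.sqrt_pos.2 this, ?_⟩
      rw [Real.sq_sqrt this.le]
      field_simp
      ring
  have hderiv : ∀ ρ ∈ Set.Ioi (0 : ℝ), HasDerivWithinAt u (2 * ρ / (r * x)) (Set.Ioi 0) ρ := by
    intro ρ _
    have := (((hasDerivAt_pow 2 ρ).div_const (r * x)).const_add 1).hasDerivWithinAt
      (s := Set.Ioi 0)
    simpa only [Nat.cast_ofNat, Nat.add_one_sub_one, pow_one] using this
  rw [expIntegralE1, ← himg, integral_image_eq_integral_deriv_smul_of_monotoneOn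
    measurableSet_Ioi hderiv hmono.monotoneOn, ← integral_mul_const]
  refine setIntegral_congr_fun measurableSet_Ioi fun ρ hρ => ?_
  have hρ' : (0 : ℝ) < ρ := hρ
  have e : -u ρ * x = -(ρ ^ 2 / r) + -x := by
    simp only [hu]
    field_simp
    ring
  simp only [smul_eq_mul]
  rw [e, Real.exp_add]
  have e2 : Real.exp (-x) * Real.exp x = 1 := by rw [← Real.exp_add, neg_add_cancel, Real.exp_zero]
  calc 2 * ρ / (r * x) * (Real.exp (-(ρ ^ 2 / r)) * Real.exp (-x) / u ρ) * Real.exp x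
      = 2 * ρ / (r * x) * Real.exp (-(ρ ^ 2 / r)) / u ρ * (Real.exp (-x) * Real.exp x) := by ring
    _ = _ := by
      rw [e2, mul_one]
      simp only [hu]
      field_simp
      ring

/-- In polar coordinates the integrand is radial; the angular factor `(2π)⁻¹` integrates to one. -/
lemma integral_inv_complexGaussian {r : ℝ≥0} (hr : 0 < r) {x : ℝ} (hx : 0 < x) :
    ∫ z : ℂ, (‖z‖ ^ 2 / r + x)⁻¹ ∂(complexGaussian r) = expIntegralE1 x * Real.exp x := by
  have hr' : (0 : ℝ) < r := hr
  have hm : Measurable (gaussianDensity r 0) := by unfold gaussianDensity; fun_prop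
  rw [complexGaussian_eq_withDensity hr, integral_withDensity_eq_integral_toReal_smul
    hm.ennreal_ofReal (ae_of_all _ fun _ => ENNReal.ofReal_lt_top),
    ← Complex.integral_comp_polarCoord_symm, polarCoord_target,
    expIntegralE1_eq_integral_Ioi hr' hx]
  have hpt : ∀ q ∈ Set.Ioi (0 : ℝ) ×ˢ Set.Ioo (-Real.pi) Real.pi,
      q.1 • (ENNReal.ofReal (gaussianDensity r 0 (Complex.polarCoord.symm q))).toReal •
        (‖Complex.polarCoord.symm q‖ ^ 2 / (r : ℝ) + x)⁻¹ =
      (2 * q.1 / r * Real.exp (-(q.1 ^ 2 / r)) / (q.1 ^ 2 / r + x)) * (2 * Real.pi)⁻¹ := by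
    rintro q -
    rw [ENNReal.toReal_ofReal (gaussianDensity_pos hr _ _).le, gaussianDensity, sub_zero,
      Complex.norm_polarCoord_symm, sq_abs, smul_eq_mul, smul_eq_mul]
    have : 0 < q.1 ^ 2 / r + x := by positivity
    field_simp
  rw [setIntegral_congr_fun (measurableSet_Ioi.prod measurableSet_Ioo) hpt, Measure.volume_eq_prod,
    setIntegral_prod_mul (fun ρ : ℝ => 2 * ρ / r * Real.exp (-(ρ ^ 2 / r)) / (ρ ^ 2 / r + x))
      (fun _ : ℝ => (2 * Real.pi)⁻¹)]
  have hpi := Real.pi_pos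
  rw [setIntegral_const, Real.volume_real_Ioo_of_le (by linarith), smul_eq_mul]
  rw [show (Real.pi - -Real.pi) * (2 * Real.pi)⁻¹ = 1 by field_simp; ring, mul_one]

lemma integrable_sinr_term {D : Downlink} (hσ : 0 < D.σ2) (hκt : 0 < D.κt) (μ : Measure ℂ)
    [IsFiniteMeasure μ] :
    Integrable (fun z : ℂ => (D.p * ‖z‖ ^ 2 / (D.κt * D.p * ‖z‖ ^ 2 + D.σ2) : ℝ)) μ := by
  have hσ' : (0 : ℝ) < D.σ2 := hσ
  have hκ' : (0 : ℝ) < D.κt := hκt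
  refine Integrable.of_bound (Measurable.aestronglyMeasurable (by fun_prop)) (1 / D.κt : ℝ)
    (ae_of_all _ fun z => ?_)
  rw [Real.norm_of_nonneg (by positivity), div_le_div_iff₀ (by positivity) hκ']
  nlinarith

lemma integral_sinr_term {D : Downlink} (hp : 0 < D.p) (hσ : 0 < D.σ2) (hκt : 0 < D.κt)
    {r : ℝ≥0} (hr : 0 < r) :
    ∫ z : ℂ, (D.p * ‖z‖ ^ 2 / (D.κt * D.p * ‖z‖ ^ 2 + D.σ2) : ℝ) ∂(complexGaussian r) =
      1 / (D.κt : ℝ) * (1 - D.σ2 / (D.p * D.κt * r) * expIntegralE1 (D.σ2 / (D.p * D.κt * r)) *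
        Real.exp (D.σ2 / (D.p * D.κt * r))) := by
  have hσ' : (0 : ℝ) < D.σ2 := hσ
  have hκ' : (0 : ℝ) < D.κt := hκt
  have hp' : (0 : ℝ) < D.p := hp
  have hr' : (0 : ℝ) < r := hr
  set x : ℝ := D.σ2 / (D.p * D.κt * r) with hx
  have hx0 : 0 < x := by positivity
  have hxe : x * (D.p * D.κt * r) = D.σ2 := by
    rw [hx]
    field_simp
  have hi : Integrable (fun z : ℂ => (‖z‖ ^ 2 / (r : ℝ) + x)⁻¹) (complexGaussian r) := by
    refine Integrable.of_bound (Measurable.aestronglyMeasurable (by fun_prop)) x⁻¹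
      (ae_of_all _ fun z => ?_)
    rw [Real.norm_of_nonneg (by positivity)]
    gcongr
    exact le_add_of_nonneg_left (by positivity)
  -- Partial fractions in `‖z‖² / r`, with `σ2` written as `x p κt r`.
  have hpt : ∀ z : ℂ, (D.p * ‖z‖ ^ 2 / (D.κt * D.p * ‖z‖ ^ 2 + D.σ2) : ℝ) =
      1 / D.κt * (1 - x * (‖z‖ ^ 2 / (r : ℝ) + x)⁻¹) := by
    intro z
    have h0 : 0 < ‖z‖ ^ 2 / (r : ℝ) + x := by positivity
    have h1 : 0 < ‖z‖ ^ 2 + (r : ℝ) * x := by positivity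
    have h2 : (0 : ℝ) < D.κt * ‖z‖ ^ 2 + x * (D.κt * r) := by positivity
    rw [← hxe]
    field_simp
    ring
  simp_rw [hpt]
  rw [integral_const_mul, integral_sub (integrable_const _) (hi.const_mul _), integral_const_mul,
    integral_inv_complexGaussian hr hx0]
  simp [mul_assoc]

variable {N : ℕ}

lemma map_coord_eq {R : Matrix (Fin N) (Fin N) ℂ} {μ : Measure (Vec N)}
    (h : IsComplexGaussian R μ) (i : Fin N) :
    μ.map (fun x : Vec N => x i) = complexGaussian (R i i).re.toNNReal := by
  -- Testing with the `i`-th unit vector picks out the variance `R i i`.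
  have := h (Pi.single i 1)
  simpa [Pi.single_apply, apply_ite, ite_mul] using this

lemma integrable_sinrBound {D : Downlink} (hσ : 0 < D.σ2) (hκt : 0 < D.κt)
    (μ : Measure (Vec N)) [IsFiniteMeasure μ] : Integrable (sinrBound D) μ := by
  refine Integrable.of_bound (measurable_sinrBound D).aestronglyMeasurable (N / D.κt : ℝ)
    (ae_of_all _ fun h => ?_)
  rw [Real.norm_of_nonneg (sinrBound_nonneg D h)]
  exact sinrBound_le hσ hκt h

lemma integral_sinrBound {D : Downlink} (hp : 0 < D.p) (hσ : 0 < D.σ2) (hκt : 0 < D.κt)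
    {R : Matrix (Fin N) (Fin N) ℂ} (hdiag : ∀ i, 0 < (R i i).re) {μ : Measure (Vec N)}
    [IsFiniteMeasure μ] (h : IsComplexGaussian R μ) :
    ∫ x, sinrBound D x ∂μ = boundG D R := by
  have hmap : ∀ i, Measurable fun x : Vec N => x i := fun i => by fun_prop
  have hg : Measurable fun z : ℂ => (D.p * ‖z‖ ^ 2 / (D.κt * D.p * ‖z‖ ^ 2 + D.σ2) : ℝ) := by
    fun_prop
  simp only [sinrBound, boundG]
  rw [integral_finsetSum]
  · refine Finset.sum_congr rfl fun i _ => ?_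
    rw [← integral_map (hmap i).aemeasurable hg.aestronglyMeasurable, map_coord_eq h i,
      integral_sinr_term hp hσ hκt (Real.toNNReal_pos.2 (hdiag i)),
      Real.coe_toNNReal _ (hdiag i).le]
  · intro i _
    have := integrable_sinr_term hσ hκt (μ.map fun x : Vec N => x i)
    exact (integrable_map_measure hg.aestronglyMeasurable (hmap i).aemeasurable).1 this

end ExpIntegral

/-- Jensen's inequality for the rate function. -/
lemma lintegral_rate_sinrBound_le {N : ℕ} {D : Downlink} (hσ : 0 < D.σ2) (hκt : 0 < D.κt)
    (μ : Measure (Vec N)) [IsProbabilityMeasure μ] :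
    ∫⁻ x, ENNReal.ofReal (rate D (sinrBound D x)) ∂μ ≤
      ENNReal.ofReal (rate D (∫ x, sinrBound D x ∂μ)) := by
  set g := ∫ x, sinrBound D x ∂μ with hg
  have hg0 : 0 ≤ g := integral_nonneg fun x => sinrBound_nonneg D x
  have hi := integrable_sinrBound hσ hκt μ
  have hi' : Integrable (fun x => (sinrBound D x - g) / ((1 + g + D.κr * g) * (1 + D.κr * g))) μ :=
    (hi.sub (integrable_const _)).div_const _
  rw [← ofReal_integral_eq_lintegral_ofReal (integrable_rate_sinrBound hσ hκt μ)
    (ae_of_all _ fun x => rate_nonneg D (sinrBound_nonneg D x))]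
  refine ENNReal.ofReal_le_ofReal ?_
  calc ∫ x, rate D (sinrBound D x) ∂μ
      ≤ ∫ x, (rate D g + (sinrBound D x - g) / ((1 + g + D.κr * g) * (1 + D.κr * g))) ∂μ :=
        integral_mono (integrable_rate_sinrBound hσ hκt μ) ((integrable_const _).add hi')
          fun x => rate_le_tangent D (sinrBound_nonneg D x) hg0
    _ = rate D g := by
        rw [integral_add (integrable_const _) hi', integral_div, integral_sub hi
          (integrable_const _), ← hg]
        simp

end MISO

end

theorem theorem2 {N : ℕ} (D : MISO.Downlink) (hp : 0 < D.p) (hσ : 0 < D.σ2) (hκt : 0 < D.κt)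
    (R : Matrix (Fin N) (Fin N) ℂ) (hR : R.PosSemidef) (hdiag : ∀ i, 0 < (R i i).re)
    {Ω : Type*} [MeasurableSpace Ω] (P : Measure Ω) [IsProbabilityMeasure P]
    (h est : Ω → MISO.Vec N) (hh : Measurable h) (hest : Measurable est)
    (hlaw : MISO.IsComplexGaussian R (P.map h))
    {𝒰 : Type*} [MeasurableSpace 𝒰]
    (side : Kernel (MISO.Vec N × MISO.Vec N × MISO.Vec N) 𝒰) [IsMarkovKernel side] :
    MISO.capacity D P h est side ≤ ENNReal.ofReal (MISO.capacityUpper D R) := by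
  have : IsProbabilityMeasure (P.map h) := Measure.isProbabilityMeasure_map hh.aemeasurable
  have hlog : 0 < Real.log 2 := Real.log_pos one_lt_two
  calc MISO.capacity D P h est side
      ≤ (∫⁻ x, ENNReal.ofReal (MISO.rate D (MISO.sinrBound D x)) ∂(P.map h)) /
        ENNReal.ofReal (Real.log 2) := MISO.capacity_le_lintegral hp hσ hκt P hh hest side
    _ ≤ ENNReal.ofReal (MISO.rate D (MISO.boundG D R)) / ENNReal.ofReal (Real.log 2) := by
        rw [← MISO.integral_sinrBound hp hσ hκt hdiag hlaw]
        exact ENNReal.div_le_div_right (MISO.lintegral_rate_sinrBound_le hσ hκt _) _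
    _ = ENNReal.ofReal (MISO.capacityUpper D R) := by
        rw [← ENNReal.ofReal_div_of_pos hlog]
        -- `rate` is in nats, and `Real.logb 2` is by definition the quotient by `Real.log 2`.
        rfl
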